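/- **Conventions.** A *quasi-abelian category* is an additive category in which every morphism has a kernel and a cokernel, cokernels are stable under pullback, and kernels are stable under pushout. A quasi-abelian category $\mathcal{Q}$ is *noetherian* (resp. *artinian*) *with respect to subobjects* if for every object $X$ every ascending (resp. descending) chain of subobjects of $X$ (represented by arbitrary monomorphisms into $X$) stabilises. An object $P$ is a *strong projective generator* of $\mathcal{Q}$ if every morphism $P\to Y$ factors through every cokernel $X\twoheadrightarrow Y$, and every object $X$ of $\mathcal{Q}$ admits a cokernel $P^{(I)}\twoheadrightarrow X$ from an existing coproduct of copies of $P$ indexed by some set $I$. The category $\mathcal{L}_{\mathcal{Q}}$ is constructed as follows: take the full subcategory $\mathcal{X}$ of the homotopy category of $\mathcal{Q}$ consisting of two-term complexes $f\colon X\to Y$ with $f$ a monomorphism (so morphisms are commutative squares $(\alpha,\beta)\colon f\to f'$ modulo those of the form $(hf, f'h)$ with $h\colon Y\to X'$), and formally invert all morphisms of $\mathcal{X}$ that are both monic and epic in $\mathcal{X}$. For a ring $\Lambda$, $\mathsf{mod}\,\Lambda$ is the category of finitely generated right $\Lambda$-modules, and $\cong$ between categories means equivalence. **Theorem.** Let $\mathcal{Q}$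 be a quasi-abelian category. 1. There is a right noetherian (resp. right artinian) ring $\Lambda$ with $\mathcal{L}_{\mathcal{Q}}\cong\mathsf{mod}\,\Lambda$ if and only if $\mathcal{Q}$ is noetherian (resp. noetherian and artinian) with respect to subobjects and has a strong projective generator. 2. Moreover, in this case $\Lambda\cong\mathsf{End}_{\mathcal{Q}}(P)$, in the following sense. If $\mathcal{Q}$ is noetherian (resp. noetherian and artinian) with respect to subobjects, then for every strong projective generator $P$ of $\mathcal{Q}$ the ring $\mathsf{End}_{\mathcal{Q}}(P)$ is right noetherian (resp. right artinian) and $\mathcal{L}_{\mathcal{Q}}\cong\mathsf{mod}\,\mathsf{End}_{\mathcal{Q}}(P)$. Conversely, for every right noetherian (resp. right artinian) ring $\Lambda$ with $\mathcal{L}_{\mathcal{Q}}\cong\mathsf{mod}\,\Lambda$, the category $\mathcal{Q}$ is noetherian (resp. noetherian and artinian) with respect to subobjects and has a strong projective generator $P$ with $\Lambda\cong\mathsf{End}_{\mathcal{Q}}(P)$ as rings. -/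

import Mathlib

open CategoryTheory CategoryTheory.Limits

universe w v u

namespace QuasiAb

section Basic

variable (Q : Type u) [Category.{v} Q] [Preadditive Q]

/-- The class of morphisms which are a kernel of some morphism. -/
def kernelMaps : MorphismProperty Q := fun _ _ f => Nonempty (NormalMono f)

/-- The class of morphisms which are a cokernel of some morphism. -/
def cokernelMaps : MorphismProperty Q := fun _ _ f => Nonempty (NormalEpi f)

/-- A quasi-abelian category: an additive category in which every morphism has a kernel and a
cokernel, and in which cokernels are stable under pullback and kernels are stable under
pushout. -/
class QuasiAbelian : Prop where
  hasZeroObject : HasZeroObject Q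
  hasBinaryBiproducts : HasBinaryBiproducts Q
  hasKernels : HasKernels Q
  hasCokernels : HasCokernels Q
  cokernels_pullback : (cokernelMaps Q).IsStableUnderBaseChange
  kernels_pushout : (kernelMaps Q).IsStableUnderCobaseChange

/-- Every object satisfies the ascending chain condition on subobjects
(classes of arbitrary monomorphisms). -/
def NoetherianWrtSubobjects : Prop := ∀ X : Q, IsNoetherianObject X

/-- Every object satisfies the descending chain condition on subobjects
(classes of arbitrary monomorphisms). -/
def ArtinianWrtSubobjects : Prop := ∀ X : Q, IsArtinianObject X

variable {Q}

/-- `P` is projective: every morphism `P ⟶ Y` lifts along every cokernel `X ⟶ Y`. -/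
def IsProj (P : Q) : Prop :=
  ∀ ⦃X Y : Q⦄ (f : X ⟶ Y), cokernelMaps Q f → ∀ g : P ⟶ Y, ∃ h : P ⟶ X, h ≫ f = g

/-- `P` is a strong projective generator: it is projective, and every object `X` is the target of
a cokernel whose source is a coproduct of copies of `P`. -/
def IsStrongProjectiveGenerator (P : Q) : Prop :=
  IsProj P ∧ ∀ X : Q, ∃ (I : Type v) (c : Cofan (fun _ : I => P)) (_ : IsColimit c)
    (p : c.pt ⟶ X), cokernelMaps Q p

end Basic

section LeftHeart

variable (Q : Type u) [Category.{v} Q] [Preadditive Q]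

/-- Two-term complexes `X ⟶ Y` in `Q` whose differential is a monomorphism; morphisms are the
morphisms of complexes, that is, the commutative squares. -/
abbrev MonoComplex : Type max u v :=
  ObjectProperty.FullSubcategory (fun a : Arrow Q => Mono a.hom)

/-- Two morphisms `φ ψ : (f : X ⟶ Y) ⟶ (f' : X' ⟶ Y')` of two-term complexes are homotopic:
there is `h : Y ⟶ X'` such that `φ - ψ = (f ≫ h, h ≫ f')`. -/
def homotopic : HomRel (MonoComplex Q) := fun a b φ ψ =>
  ∃ h : a.obj.right ⟶ b.obj.left,
    a.obj.hom ≫ h = φ.hom.left - ψ.hom.left ∧ h ≫ b.obj.hom = φ.hom.right - ψ.hom.right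

/-- The full subcategory of the homotopy category of `Q` given by the two-term complexes whose
differential is a monomorphism. -/
abbrev HomotopyMono : Type max u v := CategoryTheory.Quotient (homotopic Q)

/-- The regular morphisms: those that are both monic and epic in the homotopy category of
two-term complexes. -/
def regularMaps : MorphismProperty (HomotopyMono Q) := fun _ _ f => Mono f ∧ Epi f

/-- The (left) associated abelian category of `Q`: the category obtained from `HomotopyMono Q` by
formally inverting all regular morphisms. -/
abbrev LeftAbelian : Type max u v := (regularMaps Q).Localization

end LeftHeart

section Modules

variable (Λ : Type w) [Ring Λ]

/-- `Λ` is right noetherian. -/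
def IsRightNoetherian : Prop := IsNoetherian Λᵐᵒᵖ Λ

/-- `Λ` is right artinian. -/
def IsRightArtinian : Prop := IsArtinian Λᵐᵒᵖ Λ

/-- The category `mod Λ` of finitely generated right `Λ`-modules. -/
abbrev SmallMod : Type (w + 1) := FGModuleCat.{w} Λᵐᵒᵖ

end Modules

end QuasiAb

namespace QuasiAb

/-! ### Cokernels and image factorizations in quasi-abelian categories -/

section QuasiAbelianBasics

variable {Q : Type u} [Category.{v} Q] [Preadditive Q]

/-- Testing against every morphism killed by `e` avoids choosing a kernel. -/
theorem cokernelMaps_iff [HasKernels Q] {X Y : Q} (e : X ⟶ Y) :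
    cokernelMaps Q e ↔ Epi e ∧ ∀ ⦃Z : Q⦄ (g : X ⟶ Z),
      (∀ ⦃T : Q⦄ (t : T ⟶ X), t ≫ e = 0 → t ≫ g = 0) → ∃ h : Y ⟶ Z, e ≫ h = g := by
  constructor
  · rintro ⟨he⟩
    refine ⟨⟨fun a b h => Cofork.IsColimit.hom_ext he.isColimit h⟩, fun Z g hg => ?_⟩
    obtain ⟨l, hl⟩ := CokernelCofork.IsColimit.desc' he.isColimit g (hg _ he.w)
    exact ⟨l, hl⟩
  · rintro ⟨he, H⟩
    have key : ∀ ⦃Z : Q⦄ (g : X ⟶ Z), kernel.ι e ≫ g = 0 → ∃ h : Y ⟶ Z, e ≫ h = g := by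
      intro Z g hg
      refine H g fun T t ht => ?_
      rw [← kernel.lift_ι e t ht, Category.assoc, hg, comp_zero]
    choose d hd using key
    exact ⟨{
      W := kernel e
      g := kernel.ι e
      w := kernel.condition e
      isColimit := CokernelCofork.IsColimit.ofπ e _ (fun g hg => d g hg) (fun g hg => hd g hg)
        (fun g hg m hm => by rw [← cancel_epi e, hm, hd]) }⟩

theorem cokernelMaps_cokernel_π {X Y : Q} (f : X ⟶ Y) [HasCokernel f] :
    cokernelMaps Q (cokernel.π f) :=
  ⟨{ W := X, g := f, w := cokernel.condition f, isColimit := cokernelIsCokernel f }⟩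

theorem cokernelMaps.epi {X Y : Q} {e : X ⟶ Y} (he : cokernelMaps Q e) : Epi e := by
  obtain ⟨he⟩ := he
  exact ⟨fun a b h => Cofork.IsColimit.hom_ext he.isColimit h⟩

theorem cokernelMaps.exists_desc {X Y Z : Q} {e : X ⟶ Y} (he : cokernelMaps Q e) (g : X ⟶ Z)
    (hg : ∀ ⦃T : Q⦄ (t : T ⟶ X), t ≫ e = 0 → t ≫ g = 0) : ∃ h : Y ⟶ Z, e ≫ h = g := by
  obtain ⟨he⟩ := he
  obtain ⟨l, hl⟩ := CokernelCofork.IsColimit.desc' he.isColimit g (hg _ he.w)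
  exact ⟨l, hl⟩

/-- Cokernels are orthogonal to monomorphisms. -/
theorem cokernelMaps.exists_lift {X Y A B : Q} {e : X ⟶ Y} (he : cokernelMaps Q e) {m : A ⟶ B}
    [Mono m] (a : X ⟶ A) (b : Y ⟶ B) (h : a ≫ m = e ≫ b) : ∃ l : Y ⟶ A, l ≫ m = b := by
  obtain ⟨l, hl⟩ := he.exists_desc a fun T t ht => by
    rw [← cancel_mono m, Category.assoc, h, reassoc_of% ht, zero_comp, zero_comp]
  have := he.epi
  exact ⟨l, by rw [← cancel_epi e, reassoc_of% hl, h]⟩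

theorem cokernelMaps.isIso_of_fac {X A Y : Q} {e : X ⟶ Y} (he : cokernelMaps Q e)
    (a : X ⟶ A) (m : A ⟶ Y) [Mono m] (h : a ≫ m = e) : IsIso m := by
  obtain ⟨l, hl⟩ := he.exists_lift a (𝟙 Y) (by rw [h, Category.comp_id])
  exact ⟨l, by rw [← cancel_mono m, Category.assoc, hl, Category.comp_id, Category.id_comp], hl⟩

variable [QuasiAbelian Q]

instance hasZeroObject_of_quasiAbelian : HasZeroObject Q := QuasiAbelian.hasZeroObject

instance hasBinaryBiproducts_of_quasiAbelian : HasBinaryBiproducts Q :=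
  QuasiAbelian.hasBinaryBiproducts

instance hasKernels_of_quasiAbelian : HasKernels Q := QuasiAbelian.hasKernels

instance hasCokernels_of_quasiAbelian : HasCokernels Q := QuasiAbelian.hasCokernels

instance isStableUnderBaseChange_cokernelMaps : (cokernelMaps Q).IsStableUnderBaseChange :=
  QuasiAbelian.cokernels_pullback

instance hasFiniteProducts_of_quasiAbelian : HasFiniteProducts Q :=
  hasFiniteProducts_of_has_binary_and_terminal

instance hasFiniteBiproducts_of_quasiAbelian : HasFiniteBiproducts Q :=
  HasFiniteBiproducts.of_hasFiniteProducts

instance hasPullbacks_of_quasiAbelian : HasPullbacks Q :=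
  have : HasEqualizers Q := Preadditive.hasEqualizers_of_hasKernels
  hasPullbacks_of_hasBinaryProducts_of_hasEqualizers Q

theorem cokernelMaps_pullback_snd {X Y Z : Q} (e : X ⟶ Z) (g : Y ⟶ Z) (he : cokernelMaps Q e) :
    cokernelMaps Q (pullback.snd e g) :=
  MorphismProperty.pullback_snd e g he

theorem cokernelMaps_pullback_fst {X Y Z : Q} (g : Y ⟶ Z) (e : X ⟶ Z) (he : cokernelMaps Q e) :
    cokernelMaps Q (pullback.fst g e) :=
  MorphismProperty.pullback_fst g e he

/-- Every morphism factors as a cokernel followed by a monomorphism. -/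
theorem exists_cokernel_mono_factorization {X Y : Q} (f : X ⟶ Y) :
    ∃ (I : Q) (e : X ⟶ I) (m : I ⟶ Y), cokernelMaps Q e ∧ Mono m ∧ e ≫ m = f := by
  let e := cokernel.π (kernel.ι f)
  have he : cokernelMaps Q e := cokernelMaps_cokernel_π _
  let m : cokernel (kernel.ι f) ⟶ Y := cokernel.desc (kernel.ι f) f (kernel.condition f)
  have fac : e ≫ m = f := cokernel.π_desc _ _ _
  -- If `t ≫ m = 0`, pull `e` back along `t`: the pullback is still epic, and its other leg is
  -- killed by `f`, so it factors through the kernel and dies under `e`.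
  refine ⟨_, e, m, he, Preadditive.mono_of_cancel_zero m fun {T} t ht => ?_, fac⟩
  have hs := cokernelMaps_pullback_snd e t he
  have := hs.epi
  rw [← cancel_epi (pullback.snd e t), comp_zero, ← pullback.condition]
  have h0 : pullback.fst e t ≫ e ≫ m = 0 := by
    rw [pullback.condition_assoc, ht, comp_zero]
  rw [fac] at h0
  rw [← kernel.lift_ι f _ h0, Category.assoc, cokernel.condition, comp_zero]

end QuasiAbelianBasics

end QuasiAb

namespace QuasiAb

/-! ### The homotopy category of monomorphisms and its regular morphisms -/

section HomotopyCategory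

open ZeroObject

variable {Q : Type u} [Category.{v} Q]

instance mono_hom (a : MonoComplex Q) : Mono a.obj.hom := a.property

theorem MonoComplex.w {a b : MonoComplex Q} (φ : a ⟶ b) :
    φ.hom.left ≫ b.obj.hom = a.obj.hom ≫ φ.hom.right := Arrow.w φ.hom

/-- The two-term complex given by a monomorphism. -/
abbrev MonoComplex.mk' {X Y : Q} (f : X ⟶ Y) [Mono f] : MonoComplex Q := ⟨Arrow.mk f, ‹_›⟩

/-- The morphism of two-term complexes given by a commutative square. -/
abbrev MonoComplex.homMk {a b : MonoComplex Q} (l : a.obj.left ⟶ b.obj.left)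
    (r : a.obj.right ⟶ b.obj.right) (w : l ≫ b.obj.hom = a.obj.hom ≫ r) : a ⟶ b :=
  ObjectProperty.homMk (Arrow.homMk l r w)

variable [Preadditive Q]

/-- The differential of `b` is monic, so the degree zero equation forces the other one. -/
theorem homotopic_iff {a b : MonoComplex Q} (φ ψ : a ⟶ b) :
    homotopic Q φ ψ ↔
      ∃ h : a.obj.right ⟶ b.obj.left, h ≫ b.obj.hom = φ.hom.right - ψ.hom.right := by
  refine ⟨fun ⟨h, _, h2⟩ => ⟨h, h2⟩, fun ⟨h, h2⟩ => ⟨h, ?_, h2⟩⟩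
  rw [← cancel_mono b.obj.hom, Category.assoc, h2, Preadditive.comp_sub, Preadditive.sub_comp,
    MonoComplex.w, MonoComplex.w]

instance congruence_homotopic : Congruence (homotopic Q) where
  comp_left f g g' h := by
    rw [homotopic_iff] at h ⊢
    obtain ⟨h, hh⟩ := h
    exact ⟨f.hom.right ≫ h, by simp [hh]⟩
  comp_right {X Y Z f f'} g h := by
    rw [homotopic_iff] at h ⊢
    obtain ⟨h, hh⟩ := h
    exact ⟨h ≫ g.hom.left, by rw [Category.assoc, MonoComplex.w, reassoc_of% hh]; simp⟩
  equivalence := by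
    refine ⟨fun f => ?_, fun h => ?_, fun h h' => ?_⟩
    · rw [homotopic_iff]
      exact ⟨0, by simp⟩
    · rw [homotopic_iff] at h ⊢
      obtain ⟨h, hh⟩ := h
      exact ⟨-h, by simp [hh]⟩
    · rw [homotopic_iff] at h h' ⊢
      obtain ⟨h, hh⟩ := h
      obtain ⟨h', hh'⟩ := h'
      exact ⟨h + h', by simp [hh, hh']⟩

variable (Q) in
/-- The projection to the homotopy category. -/
abbrev toHomotopy : MonoComplex Q ⥤ HomotopyMono Q := Quotient.functor (homotopic Q)

theorem toHomotopy_map_eq_iff {a b : MonoComplex Q} (φ ψ : a ⟶ b) :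
    (toHomotopy Q).map φ = (toHomotopy Q).map ψ ↔
      ∃ h : a.obj.right ⟶ b.obj.left, h ≫ b.obj.hom = φ.hom.right - ψ.hom.right := by
  rw [Quotient.functor_map_eq_iff, homotopic_iff]

section

variable [HasZeroObject Q]

instance mono_from_zero {Y : Q} (f : (0 : Q) ⟶ Y) : Mono f :=
  ⟨fun _ _ _ => (isZero_zero Q).eq_of_tgt _ _⟩

/-- An object seen as a complex concentrated in degree zero. -/
noncomputable abbrev single (Y : Q) : MonoComplex Q := MonoComplex.mk' (0 : (0 : Q) ⟶ Y)

/-- The morphism from a complex concentrated in degree zero given by its value in degree zero. -/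
noncomputable abbrev singleDesc {Y : Q} {b : MonoComplex Q} (y : Y ⟶ b.obj.right) : single Y ⟶ b :=
  MonoComplex.homMk 0 y ((isZero_zero Q).eq_of_src _ _)

variable (Q) in
/-- The embedding of `Q` into the homotopy category as complexes concentrated in degree zero. -/
noncomputable abbrev singleFunctor : Q ⥤ HomotopyMono Q where
  obj Y := (toHomotopy Q).obj (single Y)
  map f := (toHomotopy Q).map (singleDesc (b := single _) f)
  map_id Y := by
    rw [← (toHomotopy Q).map_id]
    congr 1
    ext
    · exact (isZero_zero Q).eq_of_src _ _
    · simp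
  map_comp f g := by
    rw [← (toHomotopy Q).map_comp]
    congr 1
    ext
    · exact (isZero_zero Q).eq_of_src _ _
    · simp

instance faithful_singleFunctor : (singleFunctor Q).Faithful where
  map_injective {X Y} f g h := by
    obtain ⟨h, hh⟩ := (toHomotopy_map_eq_iff _ _).1 h
    dsimp at h hh
    rw [comp_zero] at hh
    exact (sub_eq_zero.1 hh.symm)

/-- A morphism from `single T` is just a morphism from `T` to the degree zero term, null-homotopic
when it lifts along the differential. The converse applies the criterion to the degree zero
component of an arbitrary difference. -/
theorem mono_toHomotopy_map_iff {a b : MonoComplex Q} (φ : a ⟶ b) :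
    Mono ((toHomotopy Q).map φ) ↔ ∀ ⦃T : Q⦄ (y : T ⟶ a.obj.right) (x : T ⟶ b.obj.left),
      y ≫ φ.hom.right = x ≫ b.obj.hom → ∃ x' : T ⟶ a.obj.left, x' ≫ a.obj.hom = y := by
  constructor
  · intro h T y x hxy
    have : (toHomotopy Q).map (singleDesc y) = (toHomotopy Q).map (singleDesc (b := a) 0) := by
      rw [← cancel_mono ((toHomotopy Q).map φ), ← Functor.map_comp, ← Functor.map_comp,
        toHomotopy_map_eq_iff]
      exact ⟨x, by simp [hxy]⟩
    obtain ⟨x', hx'⟩ := (toHomotopy_map_eq_iff _ _).1 this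
    exact ⟨x', by simpa using hx'⟩
  · refine fun H => ⟨fun {c} ψ ψ' h => ?_⟩
    obtain ⟨ψ, rfl⟩ := (toHomotopy Q).map_surjective (X := c.as) ψ
    obtain ⟨ψ', rfl⟩ := (toHomotopy Q).map_surjective (X := c.as) ψ'
    rw [← Functor.map_comp, ← Functor.map_comp, toHomotopy_map_eq_iff] at h
    obtain ⟨h, hh⟩ := h
    rw [toHomotopy_map_eq_iff]
    exact H _ h (by rw [hh]; simp)

end

variable [QuasiAbelian Q]

theorem epi_toHomotopy_map_iff {a b : MonoComplex Q} (φ : a ⟶ b) :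
    Epi ((toHomotopy Q).map φ) ↔ cokernelMaps Q (biprod.desc b.obj.hom φ.hom.right) := by
  constructor
  · intro h
    obtain ⟨I, e, m, he, hm, fac⟩ :=
      exists_cokernel_mono_factorization (biprod.desc b.obj.hom φ.hom.right)
    have h1 : (biprod.inl ≫ e) ≫ m = b.obj.hom := by simp [fac]
    have h2 : (biprod.inr ≫ e) ≫ m = φ.hom.right := by simp [fac]
    let c : MonoComplex Q := MonoComplex.mk' m
    -- Composed with `φ`, the map `ψ` is null-homotopic via `biprod.inr ≫ e`. Epicness makes `ψ`
    -- itself null-homotopic, and such a homotopy is a section of `m`.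
    let ψ : b ⟶ c := MonoComplex.homMk (biprod.inl ≫ e) (𝟙 _) (h1.trans (Category.comp_id _).symm)
    let ψ' : b ⟶ c := MonoComplex.homMk 0 0 (by simp)
    have : (toHomotopy Q).map ψ = (toHomotopy Q).map ψ' := by
      rw [← cancel_epi ((toHomotopy Q).map φ), ← Functor.map_comp, ← Functor.map_comp,
        toHomotopy_map_eq_iff]
      exact ⟨biprod.inr ≫ e, by simpa [c, ψ, ψ'] using h2⟩
    obtain ⟨l, hl⟩ := (toHomotopy_map_eq_iff _ _).1 this
    have hl' : l ≫ m = 𝟙 _ := by simpa [c, ψ, ψ'] using hl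
    have : IsIso m := ⟨l, by rw [← cancel_mono m, Category.assoc, hl']; simp, hl'⟩
    rw [← fac]
    exact (MorphismProperty.cancel_right_of_respectsIso _ e m).2 he
  · refine fun H => ⟨fun {c} ψ ψ' h => ?_⟩
    obtain ⟨ψ, rfl⟩ := (toHomotopy Q).map_surjective (Y := c.as) ψ
    obtain ⟨ψ', rfl⟩ := (toHomotopy Q).map_surjective (Y := c.as) ψ'
    rw [← Functor.map_comp, ← Functor.map_comp, toHomotopy_map_eq_iff] at h
    obtain ⟨h, hh⟩ := h
    rw [toHomotopy_map_eq_iff]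
    refine H.exists_lift (biprod.desc (ψ.hom.left - ψ'.hom.left) h) _ ?_
    ext
    · simp
    · simp [hh]

theorem regularMaps_iff {a b : MonoComplex Q} (φ : a ⟶ b) :
    regularMaps Q ((toHomotopy Q).map φ) ↔
      (∀ ⦃T : Q⦄ (y : T ⟶ a.obj.right) (x : T ⟶ b.obj.left),
        y ≫ φ.hom.right = x ≫ b.obj.hom → ∃ x' : T ⟶ a.obj.left, x' ≫ a.obj.hom = y) ∧
      cokernelMaps Q (biprod.desc b.obj.hom φ.hom.right) := by
  rw [← mono_toHomotopy_map_iff, ← epi_toHomotopy_map_iff]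
  rfl

/-- A factorization through `g` is determined on `Y`. It is correct on `X` because the pullback of
`g` along `f` is epic and each pair `(x, -y)` with `f x = g y` is killed by the map. -/
theorem cokernelMaps_biprod_desc {X Y Z : Q} (f : X ⟶ Z) {g : Y ⟶ Z} (hg : cokernelMaps Q g) :
    cokernelMaps Q (biprod.desc f g) := by
  have := hg.epi
  have : Epi (biprod.desc f g) := epi_of_epi_fac (biprod.inr_desc f g)
  refine (cokernelMaps_iff _).2 ⟨this, fun W k hk => ?_⟩
  obtain ⟨h, hh⟩ := hg.exists_desc (biprod.inr ≫ k) fun T t ht => by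
    simpa using hk (t ≫ biprod.inr) (by simpa using ht)
  refine ⟨h, ?_⟩
  have hp := cokernelMaps_pullback_fst f g hg
  have := hp.epi
  ext
  · rw [← cancel_epi (pullback.fst f g)]
    have := hk (biprod.lift (pullback.fst f g) (-pullback.snd f g))
      (by simp [biprod.lift_desc, pullback.condition])
    rw [biprod.lift_eq, Preadditive.add_comp, Category.assoc, Category.assoc, ← hh] at this
    rw [biprod.inl_desc_assoc, pullback.condition_assoc]
    exact (add_neg_eq_zero.1 (by simpa using this)).symm
  · simpa using hh

theorem epi_singleFunctor_map_iff {X Y : Q} (f : X ⟶ Y) :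
    Epi ((singleFunctor Q).map f) ↔ cokernelMaps Q f := by
  rw [epi_toHomotopy_map_iff]
  refine ⟨fun h => ?_, fun h => cokernelMaps_biprod_desc _ h⟩
  have := h.epi
  have key : biprod.snd ≫ f = biprod.desc (0 : (0 : Q) ⟶ Y) f := by ext; simp
  have : IsIso (biprod.snd : (0 : Q) ⊞ X ⟶ X) := by
    refine ⟨biprod.inr, biprod.hom_ext' _ _ ((isZero_zero Q).eq_of_src _ _) ?_, by simp⟩
    simp
  refine (MorphismProperty.cancel_left_of_respectsIso (cokernelMaps Q)
    (biprod.snd : (0 : Q) ⊞ X ⟶ X) f).1 ?_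
  rw [key]
  exact h

/-- Every complex is covered by its degree zero term. -/
theorem epi_toHomotopy_map_singleDesc_id (a : MonoComplex Q) :
    Epi ((toHomotopy Q).map (singleDesc (𝟙 a.obj.right))) := by
  rw [epi_toHomotopy_map_iff]
  exact cokernelMaps_biprod_desc _ ((cokernelMaps_iff (𝟙 a.obj.right)).2
    ⟨inferInstance, fun Z g _ => ⟨g, Category.id_comp g⟩⟩)

instance isMultiplicative_regularMaps : (regularMaps Q).IsMultiplicative where
  id_mem _ := ⟨inferInstance, inferInstance⟩
  comp_mem f g hf hg := by
    obtain ⟨_, _⟩ := hf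
    obtain ⟨_, _⟩ := hg
    exact ⟨mono_comp f g, epi_comp f g⟩

/-- The right Ore condition. Pull the cokernel `a.left ⊞ a'.right ⟶ a.right` back along `φ`: of the
two components of `q`, the second is `φ'` in degree zero and the first is the homotopy making the
square commute. Taking the left term of `b'` as a pullback makes `s'` monic. -/
theorem exists_square_of_regularMaps {a a' b : MonoComplex Q} (s : a' ⟶ a)
    (hs : regularMaps Q ((toHomotopy Q).map s)) (φ : b ⟶ a) :
    ∃ (b' : MonoComplex Q) (s' : b' ⟶ b) (φ' : b' ⟶ a'),
      regularMaps Q ((toHomotopy Q).map s') ∧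
        (toHomotopy Q).map s' ≫ (toHomotopy Q).map φ =
          (toHomotopy Q).map φ' ≫ (toHomotopy Q).map s := by
  obtain ⟨hs1, hs2⟩ := (regularMaps_iff s).1 hs
  let p := pullback.fst φ.hom.right (biprod.desc a.obj.hom s.hom.right)
  let q := pullback.snd φ.hom.right (biprod.desc a.obj.hom s.hom.right)
  have hp : cokernelMaps Q p := cokernelMaps_pullback_fst _ _ hs2
  have hpq : p ≫ φ.hom.right = (q ≫ biprod.fst) ≫ a.obj.hom + (q ≫ biprod.snd) ≫ s.hom.right := by
    have : p ≫ φ.hom.right = q ≫ biprod.desc a.obj.hom s.hom.right := pullback.condition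
    rw [this, Category.assoc, Category.assoc, ← Preadditive.comp_add, ← biprod.desc_eq]
  let b' : MonoComplex Q := MonoComplex.mk' (pullback.snd b.obj.hom p)
  let s' : b' ⟶ b := MonoComplex.homMk (pullback.fst b.obj.hom p) p pullback.condition
  obtain ⟨x, hx⟩ := hs1 (pullback.snd b.obj.hom p ≫ q ≫ biprod.snd)
    (pullback.fst b.obj.hom p ≫ φ.hom.left - pullback.snd b.obj.hom p ≫ q ≫ biprod.fst) (by
      have h1 := pullback.snd b.obj.hom p ≫= hpq
      rw [← pullback.condition_assoc, ← MonoComplex.w, Preadditive.comp_add] at h1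
      simp only [Preadditive.sub_comp, Category.assoc] at h1 ⊢
      rw [h1]
      abel)
  let φ' : b' ⟶ a' := MonoComplex.homMk x (q ≫ biprod.snd) hx
  refine ⟨b', s', φ', (regularMaps_iff s').2 ⟨fun T y x h => ?_, cokernelMaps_biprod_desc _ hp⟩, ?_⟩
  · exact ⟨pullback.lift x y h.symm, pullback.lift_snd _ _ _⟩
  · rw [← Functor.map_comp, ← Functor.map_comp, toHomotopy_map_eq_iff]
    refine ⟨q ≫ biprod.fst, ?_⟩
    change _ = p ≫ φ.hom.right - (q ≫ biprod.snd) ≫ s.hom.right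
    rw [hpq]
    abel

instance hasRightCalculusOfFractions_regularMaps :
    (regularMaps Q).HasRightCalculusOfFractions where
  exists_rightFraction {X Y} φ := by
    obtain ⟨s, hs⟩ := (toHomotopy Q).map_surjective (X := Y.as) (Y := φ.Y'.as) φ.s
    obtain ⟨f, hf⟩ := (toHomotopy Q).map_surjective (X := X.as) (Y := φ.Y'.as) φ.f
    obtain ⟨b', s', φ', h, h'⟩ := exists_square_of_regularMaps s (by rw [hs]; exact φ.hs) f
    exact ⟨⟨(toHomotopy Q).map s', h, (toHomotopy Q).map φ'⟩, by rw [← hs, ← hf]; exact h'⟩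
  ext X Y Y' f₁ f₂ s hs h := by
    have := hs.1
    exact ⟨X, 𝟙 X, MorphismProperty.id_mem _ _, by rw [(cancel_mono s).1 h]⟩

/-- A monomorphism to a complex concentrated in degree zero is, up to a regular morphism,
a monomorphism between complexes concentrated in degree zero. -/
theorem exists_regularMaps_single {a : MonoComplex Q} {Y : Q} (φ : a ⟶ single Y)
    (hφ : Mono ((toHomotopy Q).map φ)) :
    ∃ (I : Q) (s : a ⟶ single I), regularMaps Q ((toHomotopy Q).map s) := by
  obtain ⟨I, e, m, he, hm, fac⟩ := exists_cokernel_mono_factorization φ.hom.right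
  have hae : a.obj.hom ≫ e = 0 := by
    rw [← cancel_mono m, Category.assoc]
    have := MonoComplex.w φ
    dsimp at this
    rw [zero_comp, ← Category.comp_id (a.obj.hom ≫ e ≫ m), Category.comp_id, fac, ← this, comp_zero]
  refine ⟨I, MonoComplex.homMk 0 e (by simp [hae]), (regularMaps_iff _).2
    ⟨fun T y x h => ?_, cokernelMaps_biprod_desc _ he⟩⟩
  refine (mono_toHomotopy_map_iff φ).1 hφ y 0 ?_
  have h' : y ≫ e = x ≫ 0 := h
  rw [← fac, reassoc_of% h']
  simp

/-- A regular morphism to a complex concentrated in degree zero is orthogonal to such complexes. -/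
theorem exists_extension_of_regularMaps {a : MonoComplex Q} {Y Y' : Q} (s : a ⟶ single Y)
    (hs : regularMaps Q ((toHomotopy Q).map s)) (φ : a ⟶ single Y') :
    ∃ f : Y ⟶ Y', (toHomotopy Q).map s ≫ (singleFunctor Q).map f = (toHomotopy Q).map φ := by
  have hs' := (epi_toHomotopy_map_iff s).1 hs.2
  -- Since `s` is monic, whatever `s.hom.right` kills comes from `a.obj.left`, where `φ.hom.right`
  -- vanishes.
  obtain ⟨f, hf⟩ := hs'.exists_desc (biprod.desc 0 φ.hom.right) fun T t ht => by
    rw [biprod.desc_eq, Preadditive.comp_add] at ht ⊢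
    obtain ⟨x, hx⟩ := (mono_toHomotopy_map_iff s).1 hs.1 (t ≫ biprod.snd) 0
      (by simpa using ht)
    have := MonoComplex.w φ
    dsimp at this
    rw [← reassoc_of% hx, ← this]
    simp
  refine ⟨f, ?_⟩
  rw [← Functor.map_comp, toHomotopy_map_eq_iff]
  refine ⟨0, ?_⟩
  have : s.hom.right ≫ f = φ.hom.right := by
    simpa using biprod.inr ≫= hf
  simp [this]

end HomotopyCategory

end QuasiAb

namespace QuasiAb

/-! ### The embedding of `Q` into a localization -/

section LocalizationFunctor

open ZeroObject

universe v' u'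

variable {Q : Type u} [Category.{v} Q] [Preadditive Q] [QuasiAbelian Q]
  {A : Type u'} [Category.{v'} A] (L : HomotopyMono Q ⥤ A) [L.IsLocalization (regularMaps Q)]

include L in
theorem faithful_of_isLocalization : L.Faithful where
  map_injective {a b} f g h := by
    obtain ⟨c, s, hs, h⟩ := (MorphismProperty.map_eq_iff_precomp L (regularMaps Q) f g).1 h
    have := hs.2
    exact (cancel_epi s).1 h

omit [QuasiAbelian Q] in
theorem isIso_map_of_regularMaps {a b : HomotopyMono Q} (s : a ⟶ b) (hs : regularMaps Q s) :
    IsIso (L.map s) :=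
  Localization.inverts L (regularMaps Q) s hs

theorem exists_fraction {a b : HomotopyMono Q} (u : L.obj a ⟶ L.obj b) :
    ∃ (c : HomotopyMono Q) (s : c ⟶ a) (f : c ⟶ b), regularMaps Q s ∧
      L.map s ≫ u = L.map f := by
  obtain ⟨φ, rfl⟩ := Localization.exists_rightFraction L (regularMaps Q) u
  exact ⟨_, φ.s, φ.f, φ.hs, φ.map_s_comp_map L _⟩

/-- Up to isomorphism of the source, every morphism to an object in the image of the localization
functor is in the image of the localization functor. -/
theorem exists_iso_fraction {Z : A} {b : HomotopyMono Q} (u : Z ⟶ L.obj b) :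
    ∃ (c : HomotopyMono Q) (e : L.obj c ≅ Z) (f : c ⟶ b), e.hom ≫ u = L.map f := by
  have := Localization.essSurj L (regularMaps Q)
  obtain ⟨c, s, f, hs, h⟩ := exists_fraction L ((L.objObjPreimageIso Z).hom ≫ u)
  have := isIso_map_of_regularMaps L s hs
  exact ⟨c, asIso (L.map s) ≪≫ L.objObjPreimageIso Z, f, by simpa using h⟩

theorem exists_iso_fraction₂ {Z : A} {b b' : HomotopyMono Q} (u : Z ⟶ L.obj b)
    (u' : Z ⟶ L.obj b') :
    ∃ (c : HomotopyMono Q) (e : L.obj c ≅ Z) (f : c ⟶ b) (f' : c ⟶ b'),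
      e.hom ≫ u = L.map f ∧ e.hom ≫ u' = L.map f' := by
  obtain ⟨c, e, f, h⟩ := exists_iso_fraction L u
  obtain ⟨c', s, f', hs, h'⟩ := exists_fraction L (e.hom ≫ u')
  have := isIso_map_of_regularMaps L s hs
  exact ⟨c', asIso (L.map s) ≪≫ e, s ≫ f, f', by simp [h], by simpa using h'⟩

theorem mono_map_of_mono {a b : HomotopyMono Q} (φ : a ⟶ b) [Mono φ] : Mono (L.map φ) where
  right_cancellation {Z} g h hgh := by
    have := faithful_of_isLocalization L
    obtain ⟨c, e, f, f', hf, hf'⟩ := exists_iso_fraction₂ L g h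
    rw [← cancel_epi e.hom, hf, hf']
    congr 1
    rw [← cancel_mono φ]
    apply L.map_injective
    simp [← hf, ← hf', hgh]

/-- Represent the mono part of the image factorization of `L.map φ` by some `n`. Then `n` is monic,
and epic because `φ` factors through it after precomposition with a regular map. So `n` is regular
and gets inverted. -/
theorem epi_map_of_epi
    (fact : ∀ ⦃X Y : A⦄ (f : X ⟶ Y), ∃ (I : A) (e : X ⟶ I) (m : I ⟶ Y),
      Epi e ∧ Mono m ∧ e ≫ m = f)
    {a b : HomotopyMono Q} (φ : a ⟶ b) [Epi φ] : Epi (L.map φ) := by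
  have := faithful_of_isLocalization L
  obtain ⟨I, e, m, he, hm, fac⟩ := fact (L.map φ)
  obtain ⟨c, i, n, hn⟩ := exists_iso_fraction L m
  obtain ⟨d, s, k, hs, hk⟩ := exists_fraction L (e ≫ i.inv)
  have := hs.2
  have hnm : Mono n := by
    have : Mono (L.map n) := by rw [← hn]; infer_instance
    exact L.mono_of_mono_map this
  have hsk : s ≫ φ = k ≫ n := L.map_injective (by simp [← hk, ← hn, fac])
  have hne : Epi n := by
    have : Epi (k ≫ n) := by rw [← hsk]; infer_instance
    exact epi_of_epi k n
  have := isIso_map_of_regularMaps L n ⟨hnm, hne⟩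
  have : IsIso m := by
    rw [show m = i.inv ≫ L.map n by simp [← hn]]
    infer_instance
  rw [← fac]
  infer_instance

/-- The canonical functor from `Q` to a localization of the homotopy category. -/
noncomputable abbrev heartFunctor : Q ⥤ A := singleFunctor Q ⋙ L

theorem toHomotopy_map_single_eq_iff {a : MonoComplex Q} {Y : Q} (φ ψ : a ⟶ single Y) :
    (toHomotopy Q).map φ = (toHomotopy Q).map ψ ↔ φ.hom.right = ψ.hom.right := by
  rw [toHomotopy_map_eq_iff]
  constructor
  · rintro ⟨h, hh⟩
    dsimp at h hh
    rw [comp_zero] at hh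
    exact sub_eq_zero.1 hh.symm
  · intro h
    exact ⟨0, by simp [h]⟩

theorem faithful_heartFunctor : (heartFunctor L).Faithful := by
  have := faithful_of_isLocalization L
  infer_instance

theorem full_heartFunctor : (heartFunctor L).Full where
  map_surjective {Y Y'} u := by
    obtain ⟨c, s, f, hs, h⟩ := exists_fraction L (a := (singleFunctor Q).obj Y)
      (b := (singleFunctor Q).obj Y') u
    obtain ⟨s, rfl⟩ := (toHomotopy Q).map_surjective (X := c.as) (Y := single Y) s
    obtain ⟨f, rfl⟩ := (toHomotopy Q).map_surjective (X := c.as) (Y := single Y') f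
    obtain ⟨g, hg⟩ := exists_extension_of_regularMaps s hs f
    have := isIso_map_of_regularMaps L _ hs
    refine ⟨g, ?_⟩
    rw [← cancel_epi (L.map ((toHomotopy Q).map s)), h, ← hg, L.map_comp]
    rfl

theorem mono_heartFunctor_map {Y Y' : Q} (f : Y ⟶ Y') [Mono f] : Mono ((heartFunctor L).map f) := by
  have : Mono ((singleFunctor Q).map f) := by
    rw [mono_toHomotopy_map_iff]
    intro T y x h
    refine ⟨x, ?_⟩
    have h' : y ≫ f = x ≫ 0 := h
    change x ≫ 0 = y
    rw [← cancel_mono f, h']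
    simp
  exact mono_map_of_mono L _

/-- The essential image of `Q` in the localization is closed under subobjects. -/
theorem exists_iso_heartFunctor_obj {Z : A} {Y : Q} (m : Z ⟶ (heartFunctor L).obj Y) [Mono m] :
    ∃ I : Q, Nonempty ((heartFunctor L).obj I ≅ Z) := by
  have := faithful_of_isLocalization L
  obtain ⟨c, e, n, hn⟩ := exists_iso_fraction L (b := (singleFunctor Q).obj Y) m
  obtain ⟨n, rfl⟩ := (toHomotopy Q).map_surjective (X := c.as) (Y := single Y) n
  have : Mono (L.map ((toHomotopy Q).map n)) := by rw [← hn]; infer_instance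
  obtain ⟨I, s, hs⟩ := exists_regularMaps_single n (L.mono_of_mono_map this)
  have := isIso_map_of_regularMaps L _ hs
  exact ⟨I, ⟨(asIso (L.map ((toHomotopy Q).map s))).symm ≪≫ e⟩⟩

/-- The functor `L` is not assumed additive. Joint monicity of the projections is what later yields
additivity. -/
theorem heartFunctor_hom_ext_biprod {Z : A} {Y Y' : Q} (u u' : Z ⟶ (heartFunctor L).obj (Y ⊞ Y'))
    (h : u ≫ (heartFunctor L).map biprod.fst = u' ≫ (heartFunctor L).map biprod.fst)
    (h' : u ≫ (heartFunctor L).map biprod.snd = u' ≫ (heartFunctor L).map biprod.snd) :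
    u = u' := by
  have := faithful_of_isLocalization L
  obtain ⟨c, e, f, f', hf, hf'⟩ := exists_iso_fraction₂ L (b := (singleFunctor Q).obj (Y ⊞ Y'))
    (b' := (singleFunctor Q).obj (Y ⊞ Y')) u u'
  rw [← cancel_epi e.hom, hf, hf']
  have h1 : f ≫ (singleFunctor Q).map biprod.fst = f' ≫ (singleFunctor Q).map biprod.fst :=
    L.map_injective (by
      rw [L.map_comp, L.map_comp, ← hf, ← hf', Category.assoc, Category.assoc]
      exact e.hom ≫= h)
  have h2 : f ≫ (singleFunctor Q).map biprod.snd = f' ≫ (singleFunctor Q).map biprod.snd :=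
    L.map_injective (by
      rw [L.map_comp, L.map_comp, ← hf, ← hf', Category.assoc, Category.assoc]
      exact e.hom ≫= h')
  obtain ⟨f, rfl⟩ := (toHomotopy Q).map_surjective (X := c.as) (Y := single (Y ⊞ Y')) f
  obtain ⟨f', rfl⟩ := (toHomotopy Q).map_surjective (X := c.as) (Y := single (Y ⊞ Y')) f'
  rw [← Functor.map_comp, ← Functor.map_comp, toHomotopy_map_single_eq_iff] at h1 h2
  congr 1
  rw [toHomotopy_map_single_eq_iff]
  exact biprod.hom_ext _ _ h1 h2

end LocalizationFunctor

end QuasiAb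

namespace QuasiAb

/-! ### Monomorphisms and epimorphisms of finitely generated modules -/

section FGModules

variable {R : Type w} [Ring R]

/-- The morphism from the regular module determined by an element of a module. -/
abbrev elementHom (M : FGModuleCat.{w} R) (x : M) : FGModuleCat.of R R ⟶ M :=
  ObjectProperty.homMk (ModuleCat.ofHom (LinearMap.toSpanSingleton R M x))

/-- Kernels need not be finitely generated, so injectivity is tested on the regular module. -/
theorem FGModuleCat_injective_of_mono {M N : FGModuleCat.{w} R} (f : M ⟶ N) [Mono f] :
    Function.Injective f.hom.hom := by
  intro x y hxy
  have : elementHom M x = elementHom M y := by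
    rw [← cancel_mono f]
    ext
    simpa using hxy
  simpa using congr(($this).hom.hom (1 : R))

theorem FGModuleCat_mono_of_injective {M N : FGModuleCat.{v} R} (f : M ⟶ N)
    (hf : Function.Injective f.hom.hom) : Mono f where
  right_cancellation g h hgh := by
    ext x
    exact hf congr(($hgh).hom.hom x)

theorem FGModuleCat_epi_of_surjective {M N : FGModuleCat.{v} R} (f : M ⟶ N)
    (hf : Function.Surjective f.hom.hom) : Epi f where
  left_cancellation g h hgh := by
    ext x
    obtain ⟨y, rfl⟩ := hf x
    exact congr(($hgh).hom.hom y)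

theorem FGModuleCat_surjective_of_epi {M N : FGModuleCat.{v} R} (f : M ⟶ N) [Epi f] :
    Function.Surjective f.hom.hom := by
  let C : FGModuleCat.{v} R := FGModuleCat.of R (N ⧸ LinearMap.range f.hom.hom)
  let p : N ⟶ C := ObjectProperty.homMk (ModuleCat.ofHom (LinearMap.range f.hom.hom).mkQ)
  have : p = 0 := by
    rw [← cancel_epi f]
    ext x
    exact (Submodule.Quotient.mk_eq_zero _).2 ⟨x, rfl⟩
  intro y
  exact (Submodule.Quotient.mk_eq_zero _).1 congr(($this).hom.hom y)

theorem FGModuleCat_isIso_of_bijective {M N : FGModuleCat.{v} R} (f : M ⟶ N)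
    (hf : Function.Bijective f.hom.hom) : IsIso f := by
  let e := LinearEquiv.ofBijective f.hom.hom hf
  refine ⟨ObjectProperty.homMk (ModuleCat.ofHom e.symm.toLinearMap), ?_, ?_⟩
  · ext x
    exact e.symm_apply_apply x
  · ext x
    exact e.apply_symm_apply x

theorem FGModuleCat_exists_epi_mono_factorization {M N : FGModuleCat.{v} R} (f : M ⟶ N) :
    ∃ (I : FGModuleCat.{v} R) (e : M ⟶ I) (m : I ⟶ N), Epi e ∧ Mono m ∧ e ≫ m = f :=
  ⟨FGModuleCat.of R (LinearMap.range f.hom.hom),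
    ObjectProperty.homMk (ModuleCat.ofHom f.hom.hom.rangeRestrict),
    ObjectProperty.homMk (ModuleCat.ofHom (LinearMap.range f.hom.hom).subtype),
    FGModuleCat_epi_of_surjective _ f.hom.hom.surjective_rangeRestrict,
    FGModuleCat_mono_of_injective _ Subtype.val_injective, rfl⟩

end FGModules

/-! ### From a module category to a generator and chain conditions -/

section ModuleHeart

open ZeroObject

variable {Q : Type u} [Category.{v} Q] [Preadditive Q] [QuasiAbelian Q] {R : Type w} [Ring R]
  (L : HomotopyMono Q ⥤ FGModuleCat.{w} R) [L.IsLocalization (regularMaps Q)]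

/-- The degree zero term covers the object representing the regular module. A preimage of `1` splits
the cover, and the image of `Q` is closed under subobjects. -/
theorem exists_iso_regular_module :
    ∃ P : Q, Nonempty ((heartFunctor L).obj P ≅ FGModuleCat.of R R) := by
  have := Localization.essSurj L (regularMaps Q)
  let c := L.objPreimage (FGModuleCat.of R R)
  let e : L.obj c ≅ FGModuleCat.of R R := L.objObjPreimageIso _
  have := epi_toHomotopy_map_singleDesc_id c.as
  have := epi_map_of_epi L (fun _ _ => FGModuleCat_exists_epi_mono_factorization)
    ((toHomotopy Q).map (singleDesc (𝟙 c.as.obj.right)))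
  let p : (heartFunctor L).obj c.as.obj.right ⟶ FGModuleCat.of R R :=
    L.map ((toHomotopy Q).map (singleDesc (𝟙 c.as.obj.right))) ≫ e.hom
  have hp : Epi p := epi_comp _ _
  obtain ⟨x, hx⟩ := FGModuleCat_surjective_of_epi p (1 : R)
  have h1 : elementHom _ x ≫ p = 𝟙 _ := by
    ext
    simpa using hx
  have : Mono (elementHom _ x) := mono_of_mono_fac h1
  exact exists_iso_heartFunctor_obj L (elementHom _ x)

theorem heartFunctor_map_surjective {X Y : Q} {f : X ⟶ Y} (hf : cokernelMaps Q f) :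
    Function.Surjective ((heartFunctor L).map f).hom.hom := by
  have := (epi_singleFunctor_map_iff f).2 hf
  have : Epi ((heartFunctor L).map f) :=
    epi_map_of_epi L (fun _ _ => FGModuleCat_exists_epi_mono_factorization)
      ((singleFunctor Q).map f)
  exact FGModuleCat_surjective_of_epi _

theorem cokernelMaps_of_heartFunctor_map_surjective {X Y : Q} {f : X ⟶ Y}
    (hf : Function.Surjective ((heartFunctor L).map f).hom.hom) : cokernelMaps Q f := by
  have := faithful_of_isLocalization L
  have : Epi (L.map ((singleFunctor Q).map f)) := FGModuleCat_epi_of_surjective _ hf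
  exact (epi_singleFunctor_map_iff f).1 (L.epi_of_epi_map this)

section

variable {P : Q} (e : (heartFunctor L).obj P ≅ FGModuleCat.of R R)

theorem exists_hom_of_element {X : Q} (x : (heartFunctor L).obj X) :
    ∃ f : P ⟶ X, ((heartFunctor L).map f).hom.hom (e.inv.hom.hom (1 : R)) = x := by
  have := full_heartFunctor L
  obtain ⟨f, hf⟩ := (heartFunctor L).map_surjective (e.hom ≫ elementHom _ x)
  refine ⟨f, ?_⟩
  rw [hf]
  have := congr(($(e.inv_hom_id)).hom.hom (1 : R))
  simp only [FGModuleCat.hom_hom_comp, LinearMap.comp_apply] at this ⊢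
  rw [this]
  simp

theorem hom_ext_of_element {X : Q} (f g : P ⟶ X)
    (h : ((heartFunctor L).map f).hom.hom (e.inv.hom.hom (1 : R)) =
      ((heartFunctor L).map g).hom.hom (e.inv.hom.hom (1 : R))) : f = g := by
  have := faithful_heartFunctor L
  apply (heartFunctor L).map_injective
  rw [← cancel_epi e.inv]
  ext
  exact h

include e in
theorem isStrongProjectiveGenerator_of_iso : IsStrongProjectiveGenerator P := by
  refine ⟨fun X Y f hf g => ?_, fun X => ?_⟩
  · obtain ⟨x, hx⟩ := heartFunctor_map_surjective L hf
      (((heartFunctor L).map g).hom.hom (e.inv.hom.hom (1 : R)))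
    obtain ⟨h, rfl⟩ := exists_hom_of_element L e x
    refine ⟨h, hom_ext_of_element L e _ _ ?_⟩
    rw [← hx, Functor.map_comp]
    rfl
  · obtain ⟨n, F, hF⟩ := Module.Finite.exists_fin' R ((heartFunctor L).obj X)
    -- `ULift` only moves the finite index set into the universe of morphisms required of a
    -- generator.
    choose f hf using fun i : ULift.{v} (Fin n) =>
      exists_hom_of_element L e (F (Pi.single i.down 1))
    refine ⟨ULift.{v} (Fin n), (biproduct.bicone fun _ => P).toCocone, biproduct.isColimit _,
      biproduct.desc f, cokernelMaps_of_heartFunctor_map_surjective L fun x => ?_⟩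
    obtain ⟨r, rfl⟩ := hF x
    rw [← LinearMap.mem_range, LinearMap.pi_apply_eq_sum_univ F r]
    refine Submodule.sum_mem _ fun i _ => Submodule.smul_mem _ _ ?_
    refine ⟨((heartFunctor L).map (biproduct.ι (fun _ => P) ⟨i⟩)).hom.hom
      (e.inv.hom.hom (1 : R)), ?_⟩
    have h1 := hf ⟨i⟩
    rw [← biproduct.ι_desc f ⟨i⟩, Functor.map_comp] at h1
    refine Eq.trans h1 ?_
    congr 1
    ext j
    simp [Pi.single_apply, eq_comm]

end

theorem heartFunctor_le_iff {X Y Z : Q} (s : Y ⟶ X) (t : Z ⟶ X) [Mono t] :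
    LinearMap.range ((heartFunctor L).map s).hom.hom ≤
      LinearMap.range ((heartFunctor L).map t).hom.hom ↔ ∃ u : Y ⟶ Z, u ≫ t = s := by
  have := full_heartFunctor L
  have := faithful_heartFunctor L
  constructor
  · intro h
    have := mono_heartFunctor_map L t
    have ht := FGModuleCat_injective_of_mono ((heartFunctor L).map t)
    -- Inclusion of ranges followed by the inverse of an injection onto its range; fullness brings
    -- it back to `Q`.
    let l : (heartFunctor L).obj Y →ₗ[R] (heartFunctor L).obj Z :=
      (LinearEquiv.ofInjective _ ht).symm.toLinearMap ∘ₗ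
        (Submodule.inclusion h ∘ₗ ((heartFunctor L).map s).hom.hom.rangeRestrict)
    obtain ⟨u, hu⟩ := (heartFunctor L).map_surjective
      (ObjectProperty.homMk (ModuleCat.ofHom l) : (heartFunctor L).obj Y ⟶ (heartFunctor L).obj Z)
    refine ⟨u, (heartFunctor L).map_injective ?_⟩
    rw [Functor.map_comp, hu]
    ext x
    exact congr_arg Subtype.val ((LinearEquiv.ofInjective _ ht).apply_symm_apply
      (Submodule.inclusion h (((heartFunctor L).map s).hom.hom.rangeRestrict x)))
  · rintro ⟨u, rfl⟩
    rw [Functor.map_comp]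
    exact LinearMap.range_comp_le_range _ _

/-- Subobjects of `X` embed in the submodules of the image of `X`. -/
noncomputable def subobjectEmbedding (X : Q) :
    Subobject X ↪o Submodule R ((heartFunctor L).obj X) :=
  OrderEmbedding.ofMapLEIff (fun S => LinearMap.range ((heartFunctor L).map S.arrow).hom.hom)
    fun S T => by
      rw [heartFunctor_le_iff]
      exact ⟨fun ⟨u, hu⟩ => Subobject.le_of_comm u hu,
        fun h => ⟨Subobject.ofLE S T h, Subobject.ofLE_arrow h⟩⟩

include L in
theorem noetherianWrtSubobjects_of_isNoetherianRing [IsNoetherianRing R] :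
    NoetherianWrtSubobjects Q := fun X =>
  ⟨(subobjectEmbedding L X).strictMono.wellFoundedGT⟩

include L in
theorem artinianWrtSubobjects_of_isArtinianRing [IsArtinianRing R] :
    ArtinianWrtSubobjects Q := fun X =>
  ⟨(subobjectEmbedding L X).strictMono.wellFoundedLT⟩

theorem heartFunctor_map_zero_apply {X Y : Q} (x : (heartFunctor L).obj X) :
    ((heartFunctor L).map (0 : X ⟶ Y)).hom.hom x = 0 := by
  have := full_heartFunctor L
  -- Fullness lifts the zero endomorphism to an endomorphism of the zero object, necessarily the
  -- identity.
  have h : (0 : (heartFunctor L).obj (0 : Q) ⟶ (heartFunctor L).obj (0 : Q)) = 𝟙 _ := by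
    obtain ⟨f, hf⟩ := (heartFunctor L).map_surjective
      (0 : (heartFunctor L).obj (0 : Q) ⟶ (heartFunctor L).obj (0 : Q))
    rw [← hf, ← CategoryTheory.Functor.map_id, (isZero_zero Q).eq_of_src f (𝟙 _)]
  have h0 : (heartFunctor L).map (0 : X ⟶ Y) = 0 := by
    rw [← zero_comp (X := X) (f := (0 : (0 : Q) ⟶ Y)), Functor.map_comp,
      ← Category.id_comp ((heartFunctor L).map (0 : (0 : Q) ⟶ Y)), ← h, zero_comp, comp_zero]
  rw [h0]
  rfl

/-- The sum `f + g` is `biprod.lift f g` followed by the codiagonal, and the functor respects this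
because elements over `Y ⊞ Y` are determined by their two projections. -/
theorem heartFunctor_map_add_apply {X Y : Q} (f g : X ⟶ Y) (x : (heartFunctor L).obj X) :
    ((heartFunctor L).map (f + g)).hom.hom x =
      ((heartFunctor L).map f).hom.hom x + ((heartFunctor L).map g).hom.hom x := by
  have comp {A B C : Q} (a : A ⟶ B) (b : B ⟶ C) (y : (heartFunctor L).obj A) :
      ((heartFunctor L).map b).hom.hom (((heartFunctor L).map a).hom.hom y) =
        ((heartFunctor L).map (a ≫ b)).hom.hom y := by
    rw [Functor.map_comp]
    rfl
  have ext_elem (y z : (heartFunctor L).obj (Y ⊞ Y))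
      (h : ((heartFunctor L).map biprod.fst).hom.hom y =
        ((heartFunctor L).map biprod.fst).hom.hom z)
      (h' : ((heartFunctor L).map biprod.snd).hom.hom y =
        ((heartFunctor L).map biprod.snd).hom.hom z) : y = z := by
    have := heartFunctor_hom_ext_biprod L (elementHom _ y) (elementHom _ z)
      (by ext; simpa using h) (by ext; simpa using h')
    simpa using congr(($this).hom.hom (1 : R))
  have key : ((heartFunctor L).map (biprod.lift f g)).hom.hom x =
      ((heartFunctor L).map biprod.inl).hom.hom (((heartFunctor L).map f).hom.hom x) +
      ((heartFunctor L).map biprod.inr).hom.hom (((heartFunctor L).map g).hom.hom x) := by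
    apply ext_elem
    · rw [map_add, comp, comp, comp, comp, comp]
      simpa [-Functor.comp_map] using heartFunctor_map_zero_apply L x
    · rw [map_add, comp, comp, comp, comp, comp]
      simpa [-Functor.comp_map] using heartFunctor_map_zero_apply L x
  have hfg : f + g = biprod.lift f g ≫ biprod.desc (𝟙 Y) (𝟙 Y) := by simp
  rw [hfg, ← comp, key, map_add, comp, comp, comp, comp, biprod.inl_desc, biprod.inr_desc,
    Category.comp_id, Category.comp_id]

/-- The endomorphism ring of an object of `Q` is the endomorphism ring of the associated module. -/
noncomputable def endRingEquivHeart (P : Q) :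
    End P ≃+* Module.End R ((heartFunctor L).obj P) :=
  RingEquiv.ofBijective
    ({  toFun := fun f => ((heartFunctor L).map f).hom.hom
        map_one' := by
          rw [End.one_def, CategoryTheory.Functor.map_id]
          rfl
        map_mul' := fun f g => by
          rw [End.mul_def, Functor.map_comp]
          rfl
        map_zero' := LinearMap.ext fun x => heartFunctor_map_zero_apply L x
        map_add' := fun f g => LinearMap.ext fun x => heartFunctor_map_add_apply L f g x } :
      End P →+* Module.End R ((heartFunctor L).obj P))
    ⟨fun f g h => by
      have := faithful_heartFunctor L
      exact (heartFunctor L).map_injective (FGModuleCat.hom_ext h), fun f => by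
      have := full_heartFunctor L
      obtain ⟨g, hg⟩ := (heartFunctor L).map_surjective
        (ObjectProperty.homMk (ModuleCat.ofHom f) :
          (heartFunctor L).obj P ⟶ (heartFunctor L).obj P)
      exact ⟨g, congr(($hg).hom.hom)⟩⟩

include L in
/-- If the heart is the category of finitely generated modules over `R`, then `R` is opposite
to the endomorphism ring of a strong projective generator. -/
theorem exists_isStrongProjectiveGenerator :
    ∃ P : Q, IsStrongProjectiveGenerator P ∧ Nonempty (Rᵐᵒᵖ ≃+* End P) := by
  obtain ⟨P, ⟨e⟩⟩ := exists_iso_regular_module L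
  exact ⟨P, isStrongProjectiveGenerator_of_iso L e,
    ⟨(RingEquiv.moduleEndSelf R).trans
      (((FGModuleCat.isoToLinearEquiv e).conjRingEquiv.symm).trans (endRingEquivHeart L P).symm)⟩⟩

end ModuleHeart

end QuasiAb

/-! ### A criterion for localization functors -/

namespace QuasiAb

/-- A faithful functor which is full on morphisms from sufficiently many objects is a localization
functor. -/
theorem isLocalization_of_faithful {C : Type*} {D : Type*} [Category* C] [Category* D] (F : C ⥤ D)
    [F.Faithful] (h : ∀ M : D, ∃ c : C, Nonempty (M ≅ F.obj c) ∧
      ∀ a : C, Function.Surjective (F.map : (c ⟶ a) → (F.obj c ⟶ F.obj a))) :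
    F.IsLocalization ((MorphismProperty.isomorphisms D).inverseImage F) := by
  choose c e hs using h
  -- These bijections make `c` a left adjoint of `F`. The unit is invertible, so `c` is fully
  -- faithful and `F` localizes at the maps it inverts.
  let E (M : D) (a : C) : (c M ⟶ a) ≃ (M ⟶ F.obj a) :=
    Equiv.ofBijective (fun f => (e M).some.hom ≫ F.map f)
      ⟨fun f g hfg => F.map_injective ((cancel_epi _).1 hfg), fun u => by
        obtain ⟨f, hf⟩ := hs M a ((e M).some.inv ≫ u)
        exact ⟨f, by simp [hf]⟩⟩
  have he : ∀ (X : D) (Y Y' : C) (g : Y ⟶ Y') (h : c X ⟶ Y), E X Y' (h ≫ g) = E X Y h ≫ F.map g :=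
    fun X Y Y' g h => by
      change (e X).some.hom ≫ F.map (h ≫ g) = ((e X).some.hom ≫ F.map h) ≫ F.map g
      simp
  let adj := Adjunction.adjunctionOfEquivLeft E he
  have : ∀ M, IsIso (adj.unit.app M) := fun M => by
    have : adj.unit.app M = (e M).some.hom ≫ F.map (𝟙 _) := by
      simp only [adj, Adjunction.adjunctionOfEquivLeft_unit_app]
      rfl
    rw [this]
    infer_instance
  have : IsIso adj.unit := NatIso.isIso_of_isIso_app _
  have := adj.fullyFaithfulLOfIsIsoUnit.full
  have := adj.fullyFaithfulLOfIsIsoUnit.faithful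
  exact adj.isLocalization'

/-! ### From a generator to modules over its endomorphism ring -/

section Generator

variable {Q : Type u} [Category.{v} Q] [Preadditive Q] {P : Q}

variable (P) in
/-- The linear map between morphism modules given by composition with a morphism. -/
def postcomp {X Y : Q} (f : X ⟶ Y) : (P ⟶ X) →ₗ[(End P)ᵐᵒᵖ] (P ⟶ Y) where
  toFun g := g ≫ f
  map_add' _ _ := Preadditive.add_comp _ _ _ _ _ _
  map_smul' _ _ := Category.assoc _ _ _

@[simp]
theorem postcomp_apply {X Y : Q} (f : X ⟶ Y) (g : P ⟶ X) : postcomp P f g = g ≫ f := rfl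

theorem op_smul_hom {X : Q} (r : End P) (f : P ⟶ X) : MulOpposite.op r • f = r ≫ f := rfl

variable [QuasiAbelian Q]

/-- Every finite family of morphisms factors through a cokernel onto a subobject. -/
theorem exists_subobject_of_family {X : Q} {n : ℕ} (f : Fin n → (P ⟶ X)) :
    ∃ (S : Subobject X) (e : (⨁ fun _ : Fin n => P) ⟶ (S : Q)),
      cokernelMaps Q e ∧ e ≫ S.arrow = biproduct.desc f := by
  obtain ⟨I, e, m, he, hm, fac⟩ := exists_cokernel_mono_factorization (biproduct.desc f)
  exact ⟨Subobject.mk m, e ≫ (Subobject.underlyingIso m).inv,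
    (MorphismProperty.cancel_right_of_respectsIso _ e _).2 he, by simp [fac]⟩

variable (P) in
/-- Every object is the target of a cokernel from a finite sum of copies of `P`. -/
def IsFiniteGenerator : Prop :=
  ∀ X : Q, ∃ (n : ℕ) (p : (⨁ fun _ : Fin n => P) ⟶ X), cokernelMaps Q p

/-- Choose `S` maximal among images of finite families `P ⟶ X`. Adjoining one more morphism cannot
enlarge it, so every `P ⟶ X` factors through `S`. The cokernel from a coproduct of copies of `P`
then factors through `S` too, which forces `S = X`. -/
theorem IsStrongProjectiveGenerator.isFiniteGenerator (hQ : NoetherianWrtSubobjects Q)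
    (hP : IsStrongProjectiveGenerator P) : IsFiniteGenerator P := by
  intro X
  have := hQ X
  let s : Set (Subobject X) := {S | ∃ (n : ℕ) (f : Fin n → (P ⟶ X))
    (e : (⨁ fun _ : Fin n => P) ⟶ (S : Q)), cokernelMaps Q e ∧ e ≫ S.arrow = biproduct.desc f}
  obtain ⟨S, ⟨n, f, e, he, hef⟩, hS⟩ := WellFounded.has_min
    (wellFounded_gt (α := Subobject X)) s (by
      obtain ⟨S, e, h, h'⟩ := exists_subobject_of_family (P := P) (X := X) (n := 0) Fin.elim0
      exact ⟨S, 0, _, e, h, h'⟩)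
  have key (g : P ⟶ X) : ∃ g' : P ⟶ (S : Q), g' ≫ S.arrow = g := by
    obtain ⟨S', e', he', hef'⟩ :=
      exists_subobject_of_family (n := n + 1) (Fin.cons g f : Fin (n + 1) → (P ⟶ X))
    obtain ⟨l, hl⟩ := he.exists_lift
      (biproduct.desc (fun i => biproduct.ι (fun _ : Fin (n + 1) => P) i.succ) ≫ e') S.arrow (by
        rw [Category.assoc, hef', hef]
        ext i
        simp)
    have hle : S ≤ S' := Subobject.le_of_comm l hl
    have heq : S = S' := by
      by_contra hne
      exact hS S' ⟨_, _, e', he', hef'⟩ (lt_of_le_of_ne hle hne)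
    subst heq
    refine ⟨biproduct.ι (fun _ : Fin (n + 1) => P) 0 ≫ e', ?_⟩
    rw [Category.assoc, hef']
    simp
  obtain ⟨I, c, hc, p, hp⟩ := hP.2 X
  choose g hg using fun i => key (c.inj i ≫ p)
  have : IsIso S.arrow := by
    refine hp.isIso_of_fac (Cofan.IsColimit.desc hc g) S.arrow ?_
    refine Cofan.IsColimit.hom_ext hc _ _ fun i => ?_
    simp [hg]
  exact ⟨n, e ≫ S.arrow, (MorphismProperty.cancel_right_of_respectsIso _ e _).2 he⟩

/-- Lift each component of a cover of `Y` by a finite sum of copies of `P`, then use orthogonality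
of cokernels to monomorphisms. -/
theorem IsFiniteGenerator.exists_lift (hP : IsFiniteGenerator P) {Y A B : Q} (m : A ⟶ B) [Mono m]
    (δ : Y ⟶ B) (h : ∀ y : P ⟶ Y, ∃ x : P ⟶ A, x ≫ m = y ≫ δ) : ∃ l : Y ⟶ A, l ≫ m = δ := by
  obtain ⟨n, p, hp⟩ := hP Y
  choose x hx using fun i => h (biproduct.ι (fun _ : Fin n => P) i ≫ p)
  refine hp.exists_lift (biproduct.desc x) δ ?_
  ext i
  simp [hx]

theorem comp_biproduct_desc_mem_span {X : Q} {n : ℕ} (f : Fin n → (P ⟶ X))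
    (x : P ⟶ ⨁ fun _ : Fin n => P) :
    x ≫ biproduct.desc f ∈ Submodule.span (End P)ᵐᵒᵖ (Set.range f) := by
  have : x ≫ biproduct.desc f = ∑ i, (x ≫ biproduct.π _ i) ≫ f i := by
    rw [biproduct.desc_eq, Preadditive.comp_sum]
    simp
  rw [this]
  refine Submodule.sum_mem _ fun i _ => ?_
  change MulOpposite.op (α := End P) (x ≫ biproduct.π (fun _ : Fin n => P) i) • f i ∈ _
  exact Submodule.smul_mem _ _ (Submodule.subset_span ⟨i, rfl⟩)

theorem IsProj.finite_hom (hP : IsProj P) (hP' : IsFiniteGenerator P) (X : Q) :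
    Module.Finite (End P)ᵐᵒᵖ (P ⟶ X) := by
  obtain ⟨n, p, hp⟩ := hP' X
  refine ⟨Submodule.fg_def.2 ⟨Set.range fun i => biproduct.ι (fun _ : Fin n => P) i ≫ p, Set.finite_range _,
    eq_top_iff.2 fun x _ => ?_⟩⟩
  obtain ⟨y, rfl⟩ := hP p hp x
  have : p = biproduct.desc fun i => biproduct.ι (fun _ : Fin n => P) i ≫ p := by ext; simp
  change y ≫ p ∈ _
  rw [show y ≫ p = y ≫ biproduct.desc fun i => biproduct.ι (fun _ : Fin n => P) i ≫ p from
    congr_arg (y ≫ ·) this]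
  exact comp_biproduct_desc_mem_span _ y

/-- Finitely generated submodules of `P ⟶ X` come from subobjects of `X`. -/
theorem IsProj.exists_subobject_of_fg (hP : IsProj P) {X : Q}
    {N : Submodule (End P)ᵐᵒᵖ (P ⟶ X)} (hN : N.FG) :
    ∃ S : Subobject X, LinearMap.range (postcomp P S.arrow) = N := by
  obtain ⟨n, f, rfl⟩ := Submodule.fg_iff_exists_fin_generating_family.1 hN
  obtain ⟨S, e, he, hef⟩ := exists_subobject_of_family f
  refine ⟨S, le_antisymm ?_ (Submodule.span_le.2 ?_)⟩
  · rintro _ ⟨x, rfl⟩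
    obtain ⟨y, rfl⟩ := hP e he x
    rw [postcomp_apply, Category.assoc, hef]
    exact comp_biproduct_desc_mem_span _ _
  · rintro _ ⟨i, rfl⟩
    exact ⟨biproduct.ι (fun _ : Fin n => P) i ≫ e, by simp [hef]⟩

theorem IsFiniteGenerator.le_of_range_le (hP : IsFiniteGenerator P) {X : Q} {S T : Subobject X}
    (h : LinearMap.range (postcomp P S.arrow) ≤ LinearMap.range (postcomp P T.arrow)) : S ≤ T := by
  obtain ⟨l, hl⟩ := hP.exists_lift T.arrow S.arrow fun y => h ⟨y, rfl⟩
  exact Subobject.le_of_comm l hl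

omit [QuasiAbelian Q] in
theorem range_postcomp_mono {X : Q} {S T : Subobject X} (h : S ≤ T) :
    LinearMap.range (postcomp P S.arrow) ≤ LinearMap.range (postcomp P T.arrow) := by
  rintro _ ⟨x, rfl⟩
  exact ⟨x ≫ Subobject.ofLE S T h, by simp⟩

/-- The ascending chain condition on finitely generated submodules suffices, and these embed
strictly monotonically in the subobjects of `X`. -/
theorem IsProj.isNoetherian_hom (hP : IsProj P) (hP' : IsFiniteGenerator P)
    (X : Q) [IsNoetherianObject X] : IsNoetherian (End P)ᵐᵒᵖ (P ⟶ X) := by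
  rw [isNoetherian_iff_fg_wellFounded]
  choose S hS using fun N : { N : Submodule (End P)ᵐᵒᵖ (P ⟶ X) // N.FG } =>
    hP.exists_subobject_of_fg N.2
  refine StrictMono.wellFoundedGT (f := S) fun N N' h => ?_
  refine lt_of_le_not_ge (hP'.le_of_range_le ?_) fun hle => ?_
  · rw [hS, hS]
    exact h.le
  · have := range_postcomp_mono (P := P) hle
    rw [hS, hS] at this
    exact h.not_ge this

/-- The noetherian condition makes every submodule finitely generated, hence given by a subobject.
-/
theorem IsProj.isArtinian_hom (hP : IsProj P) (hP' : IsFiniteGenerator P)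
    (X : Q) [IsNoetherianObject X] [IsArtinianObject X] : IsArtinian (End P)ᵐᵒᵖ (P ⟶ X) := by
  have := hP.isNoetherian_hom hP' X
  choose S hS using fun N : Submodule (End P)ᵐᵒᵖ (P ⟶ X) =>
    hP.exists_subobject_of_fg (IsNoetherian.noetherian N)
  refine (isArtinian_iff _ _).2 (StrictMono.wellFoundedLT (f := S) fun N N' h => ?_).wf
  refine lt_of_le_not_ge (hP'.le_of_range_le ?_) fun hle => ?_
  · rw [hS, hS]
    exact h.le
  · have := range_postcomp_mono (P := P) hle
    rw [hS, hS] at this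
    exact h.not_ge this

/-- The functor sending a two-term complex to the cokernel of the associated map between
morphism modules. -/
noncomputable def complexModule (hP : IsProj P) (hP' : IsFiniteGenerator P) :
    MonoComplex Q ⥤ FGModuleCat.{v} (End P)ᵐᵒᵖ where
  obj a :=
    have := hP.finite_hom hP' a.obj.right
    FGModuleCat.of _ ((P ⟶ a.obj.right) ⧸ LinearMap.range (postcomp P a.obj.hom))
  map {a b} φ := ObjectProperty.homMk (ModuleCat.ofHom
    (Submodule.mapQ _ _ (postcomp P φ.hom.right) (by
      rintro _ ⟨x, rfl⟩
      exact ⟨x ≫ φ.hom.left, by simp⟩)))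
  map_id a := by
    ext x
    exact congr_arg Submodule.Quotient.mk (Category.comp_id x)
  map_comp φ ψ := by
    ext x
    exact congr_arg Submodule.Quotient.mk (Category.assoc _ _ _).symm

/-- Equality of the induced maps gives lifts along each `P ⟶ a.obj.right`; the finite generator
glues them into one homotopy. -/
theorem complexModule_map_eq_iff (hP : IsProj P) (hP' : IsFiniteGenerator P) {a b : MonoComplex Q}
    (φ ψ : a ⟶ b) : (complexModule hP hP').map φ = (complexModule hP hP').map ψ ↔
      homotopic Q φ ψ := by
  rw [homotopic_iff]
  constructor
  · intro h
    refine hP'.exists_lift _ _ fun y => ?_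
    have := congr(($h).hom.hom (Submodule.Quotient.mk y))
    obtain ⟨x, hx⟩ := (Submodule.Quotient.eq _).1 this
    exact ⟨x, by rw [Preadditive.comp_sub]; exact hx⟩
  · rintro ⟨h, hh⟩
    ext x
    obtain ⟨x, rfl⟩ := Submodule.Quotient.mk_surjective _ x
    exact (Submodule.Quotient.eq _).2 ⟨x ≫ h, by simp [hh]⟩

/-- The functor induced by `complexModule` on the homotopy category. -/
noncomputable def homotopyModule (hP : IsProj P) (hP' : IsFiniteGenerator P) :
    HomotopyMono Q ⥤ FGModuleCat.{v} (End P)ᵐᵒᵖ :=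
  CategoryTheory.Quotient.lift _ (complexModule hP hP') fun _ _ φ ψ h =>
    (complexModule_map_eq_iff hP hP' φ ψ).2 h

instance faithful_homotopyModule (hP : IsProj P) (hP' : IsFiniteGenerator P) :
    (homotopyModule hP hP').Faithful where
  map_injective {a b} f g h := by
    obtain ⟨f, rfl⟩ := (toHomotopy Q).map_surjective (X := a.as) (Y := b.as) f
    obtain ⟨g, rfl⟩ := (toHomotopy Q).map_surjective (X := a.as) (Y := b.as) g
    exact CategoryTheory.Quotient.sound _ ((complexModule_map_eq_iff hP hP' f g).1 h)

/-- Faithful functors reflect monos and epis. Conversely, for a regular map the mono criterion at `T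
= P` gives injectivity, and projectivity applied to the cokernel criterion gives surjectivity. -/
theorem inverseImage_isomorphisms_homotopyModule (hP : IsProj P) (hP' : IsFiniteGenerator P) :
    (MorphismProperty.isomorphisms _).inverseImage (homotopyModule hP hP') = regularMaps Q := by
  ext a b f
  constructor
  · intro h
    have : IsIso ((homotopyModule hP hP').map f) := h
    exact ⟨(homotopyModule hP hP').mono_of_mono_map inferInstance,
      (homotopyModule hP hP').epi_of_epi_map inferInstance⟩
  · intro h
    obtain ⟨φ, rfl⟩ := (toHomotopy Q).map_surjective (X := a.as) (Y := b.as) f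
    obtain ⟨h1, h2⟩ := (regularMaps_iff φ).1 h
    refine FGModuleCat_isIso_of_bijective _ ⟨(injective_iff_map_eq_zero _).2 fun x hx => ?_,
      fun y => ?_⟩
    · obtain ⟨x, rfl⟩ := Submodule.Quotient.mk_surjective _ x
      obtain ⟨z, hz⟩ := (Submodule.Quotient.mk_eq_zero _).1 hx
      exact (Submodule.Quotient.mk_eq_zero _).2 (h1 x z hz.symm)
    · obtain ⟨y, rfl⟩ := Submodule.Quotient.mk_surjective _ y
      obtain ⟨x, rfl⟩ := hP _ h2 y
      refine ⟨Submodule.Quotient.mk (x ≫ biprod.snd), (Submodule.Quotient.eq _).2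
        ⟨-(x ≫ biprod.fst), ?_⟩⟩
      rw [biprod.desc_eq]
      simp

/-- Morphisms `P ⟶ Pⁿ` form a free module mapping onto `M`. The kernel is finitely generated, so it
comes from a subobject `S` of `Pⁿ`, and `S ⟶ Pⁿ` presents `M`. -/
theorem exists_complex_of_module (hP : IsProj P) (hP' : IsFiniteGenerator P)
    (hN : ∀ X : Q, IsNoetherian (End P)ᵐᵒᵖ (P ⟶ X)) (M : FGModuleCat.{v} (End P)ᵐᵒᵖ) :
    ∃ c : HomotopyMono Q, Nonempty (M ≅ (homotopyModule hP hP').obj c) ∧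
      ∀ a : HomotopyMono Q, Function.Surjective ((homotopyModule hP hP').map :
        (c ⟶ a) → ((homotopyModule hP hP').obj c ⟶ (homotopyModule hP hP').obj a)) := by
  obtain ⟨n, G, hG⟩ := Module.Finite.exists_fin' (End P)ᵐᵒᵖ M
  let coord : (P ⟶ ⨁ fun _ : Fin n => P) →ₗ[(End P)ᵐᵒᵖ] (Fin n → (End P)ᵐᵒᵖ) :=
    { toFun := fun x i => MulOpposite.op (x ≫ biproduct.π (fun _ : Fin n => P) i : P ⟶ P)
      map_add' := fun x y => by ext i; simp
      map_smul' := fun r x => by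
        ext i
        exact congr_arg MulOpposite.op (Category.assoc _ _ _) }
  have hcoord : Function.Surjective coord := fun r =>
    ⟨biproduct.lift fun i => ((r i).unop : P ⟶ P), by
      ext i
      exact congr_arg MulOpposite.op (biproduct.lift_π _ _)⟩
  have hsurj : Function.Surjective (G ∘ₗ coord) := hG.comp hcoord
  obtain ⟨S, hS⟩ := hP.exists_subobject_of_fg (IsNoetherian.noetherian (LinearMap.ker (G ∘ₗ coord)))
  let c : MonoComplex Q := MonoComplex.mk' S.arrow
  refine ⟨(toHomotopy Q).obj c, ⟨?_⟩, fun a θ => ?_⟩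
  · let E := (Submodule.quotEquivOfEq _ _ hS).trans ((G ∘ₗ coord).quotKerEquivOfSurjective hsurj)
    have : Module.Finite (End P)ᵐᵒᵖ
      ((P ⟶ ⨁ fun _ : Fin n => P) ⧸ LinearMap.range (postcomp P S.arrow)) :=
      Module.Finite.equiv E.symm
    exact E.symm.toFGModuleCatIso
  · let N := LinearMap.range (postcomp P a.as.obj.hom)
    let u : (P ⟶ ⨁ fun _ : Fin n => P) →ₗ[(End P)ᵐᵒᵖ] ((P ⟶ a.as.obj.right) ⧸ N) :=
      LinearMap.comp θ.hom.hom (LinearMap.range (postcomp P S.arrow)).mkQ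
    -- By freeness, the linear map lifts once the images of the `n` inclusions are lifted; the lift
    -- is `biproduct.desc y`.
    choose y hy using fun i => N.mkQ_surjective (u (biproduct.ι (fun _ : Fin n => P) i))
    have key (x : P ⟶ ⨁ fun _ : Fin n => P) : u x = N.mkQ (x ≫ biproduct.desc y) := by
      have hx : x = ∑ i, MulOpposite.op (α := End P) (x ≫ biproduct.π (fun _ : Fin n => P) i) •
          biproduct.ι (fun _ : Fin n => P) i := by
        simp only [op_smul_hom, Category.assoc]
        rw [← Preadditive.comp_sum, biproduct.total, Category.comp_id]
      have hx' : x ≫ biproduct.desc y =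
          ∑ i, MulOpposite.op (α := End P) (x ≫ biproduct.π (fun _ : Fin n => P) i) • y i := by
        simp only [op_smul_hom, Category.assoc]
        rw [← Preadditive.comp_sum, ← biproduct.desc_eq]
      rw [hx']
      conv_lhs => rw [hx]
      rw [map_sum, map_sum]
      refine Finset.sum_congr rfl fun i _ => ?_
      rw [map_smul, map_smul, hy]
    -- The map `u` kills the image of `S`, so the lift carries `S` into the left term of `a`.
    obtain ⟨l, hl⟩ := hP'.exists_lift a.as.obj.hom (S.arrow ≫ biproduct.desc y) fun z => by
      have h0 : u (z ≫ S.arrow) = 0 :=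
        (congr_arg θ.hom.hom ((Submodule.Quotient.mk_eq_zero _).2 ⟨z, rfl⟩)).trans
          (map_zero θ.hom.hom)
      obtain ⟨x, hx⟩ := (Submodule.Quotient.mk_eq_zero _).1 ((key (z ≫ S.arrow)).symm.trans h0)
      exact ⟨x, hx.trans (Category.assoc _ _ _)⟩
    refine ⟨(toHomotopy Q).map (MonoComplex.homMk (a := c) (b := a.as) l (biproduct.desc y) hl), ?_⟩
    ext x
    obtain ⟨x, rfl⟩ := Submodule.Quotient.mk_surjective _ x
    exact (key x).symm

theorem isLocalization_homotopyModule (hP : IsProj P) (hP' : IsFiniteGenerator P)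
    (hN : ∀ X : Q, IsNoetherian (End P)ᵐᵒᵖ (P ⟶ X)) :
    (homotopyModule hP hP').IsLocalization (regularMaps Q) := by
  rw [← inverseImage_isomorphisms_homotopyModule hP hP']
  exact isLocalization_of_faithful _ (exists_complex_of_module hP hP' hN)

end Generator

end QuasiAb

namespace QuasiAb

/-! ### Right chain conditions and the opposite ring -/

section OppositeRing

variable (R : Type w) [Ring R]

/-- The linear equivalence between a ring and its opposite, as right modules. -/
def opRightLinearEquiv : R ≃ₗ[Rᵐᵒᵖ] Rᵐᵒᵖ where
  toFun := MulOpposite.op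
  invFun := MulOpposite.unop
  map_add' _ _ := rfl
  map_smul' _ _ := rfl
  left_inv _ := rfl
  right_inv _ := rfl

variable {R}

theorem IsRightNoetherian.isNoetherianRing_op (h : IsRightNoetherian R) : IsNoetherianRing Rᵐᵒᵖ :=
  have : IsNoetherian Rᵐᵒᵖ R := h
  isNoetherian_of_linearEquiv (opRightLinearEquiv R)

theorem IsRightArtinian.isArtinianRing_op (h : IsRightArtinian R) : IsArtinianRing Rᵐᵒᵖ :=
  have : IsArtinian Rᵐᵒᵖ R := h
  (opRightLinearEquiv R).isArtinian_iff.1 this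

/-- The Hopkins–Levitzki theorem, applied to the opposite ring. -/
theorem IsRightArtinian.isRightNoetherian (h : IsRightArtinian R) : IsRightNoetherian R :=
  have := h.isArtinianRing_op
  have : IsNoetherianRing Rᵐᵒᵖ := inferInstance
  isNoetherian_of_linearEquiv (opRightLinearEquiv R).symm

end OppositeRing

/-! ### Assembling both directions -/

variable {Q : Type u} [Category.{v} Q] [Preadditive Q] [QuasiAbelian Q]

theorem isRightNoetherian_end {P : Q} (hQ : NoetherianWrtSubobjects Q)
    (hP : IsStrongProjectiveGenerator P) : IsRightNoetherian (End P) :=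
  have := hQ P
  hP.1.isNoetherian_hom (hP.isFiniteGenerator hQ) P

theorem isRightArtinian_end {P : Q} (hQ : NoetherianWrtSubobjects Q)
    (hQ' : ArtinianWrtSubobjects Q) (hP : IsStrongProjectiveGenerator P) :
    IsRightArtinian (End P) :=
  have := hQ P
  have := hQ' P
  hP.1.isArtinian_hom (hP.isFiniteGenerator hQ) P

theorem nonempty_equivalence_end {P : Q} (hQ : NoetherianWrtSubobjects Q)
    (hP : IsStrongProjectiveGenerator P) : Nonempty (LeftAbelian Q ≌ SmallMod (End P)) := by
  have hP' := hP.isFiniteGenerator hQ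
  have := isLocalization_homotopyModule hP.1 hP' fun X =>
    have := hQ X
    hP.1.isNoetherian_hom hP' X
  exact ⟨Localization.equivalenceFromModel (homotopyModule hP.1 hP') (regularMaps Q)⟩

omit [QuasiAbelian Q] in
theorem isLocalization_comp_equivalence {A : Type*} [Category* A] (E : LeftAbelian Q ≌ A) :
    ((regularMaps Q).Q ⋙ E.functor).IsLocalization (regularMaps Q) :=
  Functor.IsLocalization.of_equivalence_target (regularMaps Q).Q _ _ E (Iso.refl _)

theorem noetherianWrtSubobjects_of_equivalence {Λ : Type w} [Ring Λ] (h : IsRightNoetherian Λ)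
    (E : LeftAbelian Q ≌ SmallMod Λ) : NoetherianWrtSubobjects Q :=
  have := isLocalization_comp_equivalence E
  have := h.isNoetherianRing_op
  noetherianWrtSubobjects_of_isNoetherianRing ((regularMaps Q).Q ⋙ E.functor)

theorem artinianWrtSubobjects_of_equivalence {Λ : Type w} [Ring Λ] (h : IsRightArtinian Λ)
    (E : LeftAbelian Q ≌ SmallMod Λ) : ArtinianWrtSubobjects Q :=
  have := isLocalization_comp_equivalence E
  have := h.isArtinianRing_op
  artinianWrtSubobjects_of_isArtinianRing ((regularMaps Q).Q ⋙ E.functor)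

theorem exists_generator_of_equivalence {Λ : Type w} [Ring Λ] (E : LeftAbelian Q ≌ SmallMod Λ) :
    ∃ P : Q, IsStrongProjectiveGenerator P ∧ Nonempty (Λ ≃+* End P) := by
  have := isLocalization_comp_equivalence E
  obtain ⟨P, hP, ⟨e⟩⟩ := exists_isStrongProjectiveGenerator ((regularMaps Q).Q ⋙ E.functor)
  exact ⟨P, hP, ⟨(RingEquiv.opOp Λ).trans e⟩⟩

end QuasiAb

theorem theorem5p6 (Q : Type u) [Category.{v} Q] [Preadditive Q] [QuasiAb.QuasiAbelian Q] :
    -- the noetherian version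
    (((∃ (Λ : Type v) (_ : Ring Λ), QuasiAb.IsRightNoetherian Λ ∧
          Nonempty (QuasiAb.LeftAbelian Q ≌ QuasiAb.SmallMod Λ)) ↔
        (QuasiAb.NoetherianWrtSubobjects Q ∧
          ∃ P : Q, QuasiAb.IsStrongProjectiveGenerator P)) ∧
      (∀ P : Q, QuasiAb.NoetherianWrtSubobjects Q → QuasiAb.IsStrongProjectiveGenerator P →
        QuasiAb.IsRightNoetherian (End P) ∧
          Nonempty (QuasiAb.LeftAbelian Q ≌ QuasiAb.SmallMod (End P))) ∧
      (∀ (Λ : Type w) [Ring Λ], QuasiAb.IsRightNoetherian Λ →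
        Nonempty (QuasiAb.LeftAbelian Q ≌ QuasiAb.SmallMod Λ) →
          QuasiAb.NoetherianWrtSubobjects Q ∧
            ∃ P : Q, QuasiAb.IsStrongProjectiveGenerator P ∧ Nonempty (Λ ≃+* End P))) ∧
    -- the artinian version
    (((∃ (Λ : Type v) (_ : Ring Λ), QuasiAb.IsRightArtinian Λ ∧
          Nonempty (QuasiAb.LeftAbelian Q ≌ QuasiAb.SmallMod Λ)) ↔
        (QuasiAb.NoetherianWrtSubobjects Q ∧ QuasiAb.ArtinianWrtSubobjects Q ∧
          ∃ P : Q, QuasiAb.IsStrongProjectiveGenerator P)) ∧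
      (∀ P : Q, QuasiAb.NoetherianWrtSubobjects Q → QuasiAb.ArtinianWrtSubobjects Q →
        QuasiAb.IsStrongProjectiveGenerator P →
          QuasiAb.IsRightArtinian (End P) ∧
            Nonempty (QuasiAb.LeftAbelian Q ≌ QuasiAb.SmallMod (End P))) ∧
      (∀ (Λ : Type w) [Ring Λ], QuasiAb.IsRightArtinian Λ →
        Nonempty (QuasiAb.LeftAbelian Q ≌ QuasiAb.SmallMod Λ) →
          QuasiAb.NoetherianWrtSubobjects Q ∧ QuasiAb.ArtinianWrtSubobjects Q ∧
            ∃ P : Q, QuasiAb.IsStrongProjectiveGenerator P ∧ Nonempty (Λ ≃+* End P))) := by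
  refine ⟨⟨⟨?_, ?_⟩, ?_, ?_⟩, ⟨?_, ?_⟩, ?_, ?_⟩
  · rintro ⟨Λ, _, h, ⟨E⟩⟩
    obtain ⟨P, hP, _⟩ := QuasiAb.exists_generator_of_equivalence E
    exact ⟨QuasiAb.noetherianWrtSubobjects_of_equivalence h E, P, hP⟩
  · rintro ⟨hQ, P, hP⟩
    exact ⟨End P, inferInstance, QuasiAb.isRightNoetherian_end hQ hP,
      QuasiAb.nonempty_equivalence_end hQ hP⟩
  · exact fun P hQ hP => ⟨QuasiAb.isRightNoetherian_end hQ hP,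
      QuasiAb.nonempty_equivalence_end hQ hP⟩
  · rintro Λ _ h ⟨E⟩
    exact ⟨QuasiAb.noetherianWrtSubobjects_of_equivalence h E,
      QuasiAb.exists_generator_of_equivalence E⟩
  · rintro ⟨Λ, _, h, ⟨E⟩⟩
    obtain ⟨P, hP, _⟩ := QuasiAb.exists_generator_of_equivalence E
    exact ⟨QuasiAb.noetherianWrtSubobjects_of_equivalence h.isRightNoetherian E,
      QuasiAb.artinianWrtSubobjects_of_equivalence h E, P, hP⟩
  · rintro ⟨hQ, hQ', P, hP⟩
    exact ⟨End P, inferInstance, QuasiAb.isRightArtinian_end hQ hQ' hP,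
      QuasiAb.nonempty_equivalence_end hQ hP⟩
  · exact fun P hQ hQ' hP => ⟨QuasiAb.isRightArtinian_end hQ hQ' hP,
      QuasiAb.nonempty_equivalence_end hQ hP⟩
  · rintro Λ _ h ⟨E⟩
    exact ⟨QuasiAb.noetherianWrtSubobjects_of_equivalence h.isRightNoetherian E,
      QuasiAb.artinianWrtSubobjects_of_equivalence h E,
      QuasiAb.exists_generator_of_equivalence E⟩
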